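/- For a set $N$ of positive integers let $\mathcal{L}_{\rm ring}\cup\{P_n : n\in N\}$ be the language of rings $\{+,-,\cdot,0,1\}$ together with unary predicate symbols $P_n$ ($n\in N$). Every field $K$ is a structure for this language, with $P_n$ interpreted as the set of $n$-th powers $\{y^n : y\in K\}$. The Macintyre language is $\mathcal{L}_{\rm Mac}=\mathcal{L}_{\rm ring}\cup\{P_n : n\geq 1\}$. A $\forall$-$\emptyset$-formula is a parameter-free formula consisting of a (possibly empty) block of universal quantifiers followed by a quantifier-free formula. A formula $\varphi(x)$ in one free variable defines the valuation ring $\mathcal{O}_v$ of a valued field $(K,v)$ if $\mathcal{O}_v=\{a\in K : K\models\varphi(a)\}$. A (Krull) valuation $v$ on a field $K$ is henselian if it has, up to equivalence, a unique extension to an algebraic closure of $K$, and, for a prime $p$, it is $p$-henselian if it has, up to equivalence, a unique extension to the maximal Galois pro-$p$ extension $K(p)$ of $K$. (1) Let $p$ be a prime number and $n\in\mathbb{Z}_{\geq 0}$. There is a $\forall$-$\emptyset$-formula $\varphi(x)$ in $\mathcal{L}_{\rm ring}\cup\{P_p\}$ (depending only on $p$ and $n$) that defines the valuation ring of every $p$-henselian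 valued field $(K,v)$ with residue field $F$ and value group $\Gamma$ such that - $K$ contains a primitive $p$-th root of unity and ${\rm char}(F)\neq p$; - $|F^\times/(F^\times)^p|=p^n$; - $\Gamma$ contains no $p$-divisible convex subgroup other than the trivial subgroup $\{0\}$. (2) There is a $\forall$-$\emptyset$-formula in $\mathcal{L}_{\rm Mac}$ that defines the valuation ring of every henselian valued field $(K,v)$ whose value group is isomorphic to $\mathbb{Z}$ as an ordered group and whose residue field $F$ satisfies ${\rm char}(F)\neq 2$ and has absolute Galois group $G_F\cong\hat{\mathbb{Z}}$ (as topological groups). -/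

import Mathlib

open FirstOrder

/-! ### The languages `L_ring ∪ {P_n : n ∈ N}` -/

/-- For every `n ∈ N` one unary predicate symbol `P_n`, and no other relation symbol. -/
inductive PowerRel (N : Set ℕ) : ℕ → Type
  | pow (n : N) : PowerRel N 1

/-- The purely relational language `{P_n : n ∈ N}`. -/
def powerLanguage (N : Set ℕ) : Language :=
  { Functions := fun _ => Empty
    Relations := PowerRel N }

/-- The language `L_ring ∪ {P_n : n ∈ N}`. -/
abbrev ringPowerLanguage (N : Set ℕ) : Language :=
  Language.ring.sum (powerLanguage N)

/-- The Macintyre language `L_ring ∪ {P_n : n ≥ 1}`. -/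
abbrev macintyreLanguage : Language :=
  ringPowerLanguage {n : ℕ | 1 ≤ n}

/-- In a field `K` the symbol `P_n` is interpreted as the set of `n`-th powers of `K`. -/
@[reducible]
def powerStructure (N : Set ℕ) (K : Type*) [Field K] : (powerLanguage N).Structure K :=
  { funMap := fun f _ => f.elim
    RelMap := fun {_} R =>
      match R with
      | .pow n => fun x => ∃ y : K, y ^ (n : ℕ) = x 0 }

/-- A field as a structure for `L_ring ∪ {P_n : n ∈ N}`: the ring operations are those of the
field, and `P_n` is the set of `n`-th powers. -/
@[reducible]
def ringPowerStructure (N : Set ℕ) (K : Type*) [Field K] :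
    (ringPowerLanguage N).Structure K :=
  letI : Language.ring.Structure K := (Ring.compatibleRingOfRing K).toStructure
  letI : (powerLanguage N).Structure K := powerStructure N K
  Language.sumStructure Language.ring (powerLanguage N) K

/-- The parameter-free formula `φ(x)` in one free variable defines in the field `K` the valuation
ring of `v`. -/
def DefinesValuationRing {N : Set ℕ} (φ : (ringPowerLanguage N).Formula (Fin 1))
    {K Γ₀ : Type*} [Field K] [LinearOrderedCommGroupWithZero Γ₀] (v : Valuation K Γ₀) : Prop :=
  letI : (ringPowerLanguage N).Structure K := ringPowerStructure N K
  ∀ x : K, φ.Realize (fun _ => x) ↔ x ∈ v.valuationSubring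

/-! ### Henselian and `p`-henselian valuations -/

/-- The maximal Galois pro-`p` extension `K(p)` of `K`, as the compositum, in an algebraic closure
of `K`, of all finite Galois extensions of `K` whose degree is a power of `p`. -/
noncomputable def maximalProPExtension (p : ℕ) (K : Type*) [Field K] :
    IntermediateField K (AlgebraicClosure K) :=
  ⨆ L ∈ {L : IntermediateField K (AlgebraicClosure K) |
    FiniteDimensional K L ∧ IsGalois K L ∧ ∃ k : ℕ, Module.finrank K L = p ^ k}, L

/-- `v` has, up to equivalence, exactly one extension to the extension field `L` of `K`. Equivalence
classes of valuations on `L` are the valuation rings of `L`, and a valuation with valuation ring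
`B` extends `v`, up to equivalence, iff `B ∩ K` is the valuation ring of `v`. -/
def HasUniqueExtension {K Γ₀ : Type*} [Field K] [LinearOrderedCommGroupWithZero Γ₀]
    (v : Valuation K Γ₀) (L : Type*) [Field L] [Algebra K L] : Prop :=
  ∃! B : ValuationSubring L, B.comap (algebraMap K L) = v.valuationSubring

/-- A valuation is henselian if it has a unique extension to an algebraic closure. -/
def IsHenselianValuation {K Γ₀ : Type*} [Field K] [LinearOrderedCommGroupWithZero Γ₀]
    (v : Valuation K Γ₀) : Prop :=
  HasUniqueExtension v (AlgebraicClosure K)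

/-- A valuation is `p`-henselian if it has a unique extension to `K(p)`. -/
def IsPHenselianValuation (p : ℕ) {K Γ₀ : Type*} [Field K] [LinearOrderedCommGroupWithZero Γ₀]
    (v : Valuation K Γ₀) : Prop :=
  HasUniqueExtension v (maximalProPExtension p K)

/-! ### Value group and residue field -/

/-- The value group `v(K^×)`, written multiplicatively. -/
abbrev valueGroupOf {K Γ₀ : Type*} [Field K] [LinearOrderedCommGroupWithZero Γ₀]
    (v : Valuation K Γ₀) : Subgroup Γ₀ˣ :=
  MonoidWithZeroHom.valueGroup v.toMonoidWithZeroHom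

/-- The residue field of a valuation. -/
abbrev residueFieldOf {K Γ₀ : Type*} [Field K] [LinearOrderedCommGroupWithZero Γ₀]
    (v : Valuation K Γ₀) : Type _ :=
  IsLocalRing.ResidueField v.valuationSubring

/-- The (multiplicatively written) ordered abelian group `Γ` contains no `p`-divisible convex
subgroup other than the trivial one. -/
def NoPDivisibleConvexSubgroup (p : ℕ) (Γ : Type*) [CommGroup Γ] [LinearOrder Γ] : Prop :=
  ∀ H : Subgroup Γ, (H : Set Γ).OrdConnected → (∀ h ∈ H, ∃ g ∈ H, g ^ p = h) → H = ⊥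

/-! ### The profinite group `Ẑ` -/

/-- The additive group `Ẑ = lim ℤ/n`, as the group of compatible families in `∏_{n ≥ 1} ℤ/n` with
the topology induced by the product of the discrete topologies. -/
def zHat : AddSubgroup (∀ n : ℕ+, ZMod (n : ℕ)) where
  carrier := {x | ∀ (m n : ℕ+) (h : (m : ℕ) ∣ (n : ℕ)), ZMod.castHom h (ZMod (m : ℕ)) (x n) = x m}
  add_mem' := fun hx hy m n h => by
    rw [Pi.add_apply, map_add, hx m n h, hy m n h, Pi.add_apply]
  zero_mem' := fun m n h => by
    rw [Pi.zero_apply, map_zero, Pi.zero_apply]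
  neg_mem' := fun hx m n h => by
    rw [Pi.neg_apply, map_neg, hx m n h, Pi.neg_apply]

/-! Everything rests on one property: every one-unit `1 + a` with `v a < 1` is a `p`-th power. Given
it, let `M` be the number of `p`-th power classes of the residue field. A witness `w` in the formula
is a non-power for which `1 + w` and `x ^ p * w ^ p + w ^ (p - 1)` are powers; the formula forbids
`M` witnesses in distinct power classes.

If `x` is integral, the two power conditions force `w` to be a unit (`valuation_eq_one_of_pow`).
Power classes of units are detected in the residue field, where only `M - 1` nontrivial classes
exist, so `M` inequivalent witnesses cannot occur. If `v x > 1`, the hypothesis on convex subgroups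
gives `y` whose value is not a `p`-th power and lies strictly between those of `x ^ (-p)` and `1`
(`exists_value_not_pow_between`). The elements `u * y`, with `u` running over unit representatives
of all `M` residue classes, are then `M` inequivalent witnesses.

The one-unit property comes from uniqueness of the extended valuation
(`exists_pow_eq_of_hasUniqueExtension`): conjugate `p`-th roots of a one-unit would have to be
congruent, whereas distinct `p`-th roots of unity stay distinct in residue characteristic other than
`p`. For (2) take `p = 2`: the group `Ẑ` has exactly one nontrivial continuous quadratic character,
so the residue field has two square classes, and `M = 2`. -/

/-! ### Powers of ring terms, and the power predicates -/

section Formula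

open Language BoundedFormula

/-- The `k`-th power of a ring term. -/
def ringTermPow {α : Type*} (t : Language.ring.Term α) : ℕ → Language.ring.Term α
  | 0 => 1
  | k + 1 => ringTermPow t k * t

theorem realize_ringTermPow {α R : Type*} [CommRing R] (t : Language.ring.Term α) (k : ℕ)
    (e : α → R) :
    letI := Ring.compatibleRingOfRing R
    (ringTermPow t k).realize e = t.realize e ^ k := by
  let _ := Ring.compatibleRingOfRing R
  induction k with
  | zero => simp [ringTermPow]
  | succ k ih =>
    rw [ringTermPow, Ring.realize_mul, pow_succ]
    exact congrArg (· * _) ih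

/-- The symbol `P_p`. -/
def powSymbol {N : Set ℕ} (p : N) : (ringPowerLanguage N).Relations 1 :=
  Sum.inr (show (powerLanguage N).Relations 1 from PowerRel.pow p)

/-- The atomic formula saying that the value of a ring term is a `p`-th power. -/
def isPowFormula {N : Set ℕ} (p : N) {α : Type*} {n : ℕ}
    (t : Language.ring.Term (α ⊕ Fin n)) : (ringPowerLanguage N).BoundedFormula α n :=
  (powSymbol p).boundedFormula₁ ((LHom.sumInl : Language.ring →ᴸ ringPowerLanguage N).onTerm t)

theorem isQF_isPowFormula {N : Set ℕ} (p : N) {α : Type*} {n : ℕ}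
    (t : Language.ring.Term (α ⊕ Fin n)) : (isPowFormula p t).IsQF :=
  (IsAtomic.rel _ _).isQF

theorem realize_isPowFormula {N : Set ℕ} (p : N) {α K : Type*} [Field K] {n : ℕ}
    (t : Language.ring.Term (α ⊕ Fin n)) (e : α → K) (xs : Fin n → K) :
    letI := ringPowerStructure N K
    (isPowFormula p t).Realize e xs ↔
      letI := Ring.compatibleRingOfRing K
      ∃ y : K, y ^ (p : ℕ) = t.realize (Sum.elim e xs) := by
  let _ := Ring.compatibleRingOfRing K
  let _ : (powerLanguage N).Structure K := powerStructure N K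
  let _ := ringPowerStructure N K
  have h := LHom.realize_onTerm (LHom.sumInl : Language.ring →ᴸ ringPowerLanguage N) t
    (Sum.elim e xs)
  rw [isPowFormula, realize_rel₁, ← h]
  rfl

theorem isQF_iInf {L : Language} {α β : Type*} [Finite β] {n : ℕ}
    {f : β → L.BoundedFormula α n} (hf : ∀ b, (f b).IsQF) : (BoundedFormula.iInf f).IsQF := by
  unfold BoundedFormula.iInf
  have : ∀ l : List (L.BoundedFormula α n), (∀ φ ∈ l, φ.IsQF) →
      (l.foldr (· ⊓ ·) ⊤).IsQF := by
    intro l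
    induction l with
    | nil => exact fun _ => IsQF.top
    | cons a l ih =>
      intro h
      exact (h a (by simp)).inf (ih fun φ hφ => h φ (by simp [hφ]))
  apply this
  intro φ hφ
  obtain ⟨b, -, rfl⟩ := List.mem_map.1 hφ
  exact hf b

theorem isUniversal_alls {L : Language} {α : Type*} {n : ℕ} {φ : L.BoundedFormula α n}
    (h : φ.IsUniversal) : φ.alls.IsUniversal := by
  induction n with
  | zero => exact h
  | succ n ih => exact ih h.all

/-- The universal formula saying of `x` that there are no `w₁, …, w_M` outside the `p`-th powers and
in pairwise different classes modulo `p`-th powers such that all `1 + w_i` and all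
`x ^ p * w_i ^ p + w_i ^ (p - 1)` are `p`-th powers. -/
noncomputable def integralityFormula {N : Set ℕ} (p : N) (M : ℕ) :
    (ringPowerLanguage N).Formula (Fin 1) :=
  letI x : Language.ring.Term (Fin 1 ⊕ Fin M) := Term.var (Sum.inl 0)
  letI w : Fin M → Language.ring.Term (Fin 1 ⊕ Fin M) := fun i => Term.var (Sum.inr i)
  BoundedFormula.alls (∼(
    (BoundedFormula.iInf fun i => ∼(isPowFormula p (w i))) ⊓
    ((BoundedFormula.iInf fun ij : {ij : Fin M × Fin M // ij.1 ≠ ij.2} =>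
      ∼(isPowFormula p (w ij.1.1 * ringTermPow (w ij.1.2) (p - 1)))) ⊓
    ((BoundedFormula.iInf fun i => isPowFormula p (1 + w i)) ⊓
    (BoundedFormula.iInf fun i => isPowFormula p
      (ringTermPow x p * ringTermPow (w i) p + ringTermPow (w i) (p - 1)))))))

theorem isUniversal_integralityFormula {N : Set ℕ} (p : N) (M : ℕ) :
    (integralityFormula p M).IsUniversal :=
  isUniversal_alls (IsQF.isUniversal (IsQF.not
    ((isQF_iInf fun _ => (isQF_isPowFormula p _).not).inf
      ((isQF_iInf fun _ => (isQF_isPowFormula p _).not).inf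
        ((isQF_iInf fun _ => isQF_isPowFormula p _).inf
          (isQF_iInf fun _ => isQF_isPowFormula p _))))))

theorem realize_integralityFormula {N : Set ℕ} (p : N) (M : ℕ) {K : Type*} [Field K] (x : K) :
    letI := ringPowerStructure N K
    (integralityFormula p M).Realize (fun _ => x) ↔ ∀ w : Fin M → K,
      ¬ ((∀ i, ¬ ∃ y : K, y ^ (p : ℕ) = w i) ∧
        (∀ i j, i ≠ j → ¬ ∃ y : K, y ^ (p : ℕ) = w i * w j ^ ((p : ℕ) - 1)) ∧
        (∀ i, ∃ y : K, y ^ (p : ℕ) = 1 + w i) ∧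
        ∀ i, ∃ y : K, y ^ (p : ℕ) = x ^ (p : ℕ) * w i ^ (p : ℕ) + w i ^ ((p : ℕ) - 1)) := by
  let _ := Ring.compatibleRingOfRing K
  let _ := ringPowerStructure N K
  rw [integralityFormula, realize_alls]
  simp only [realize_not, realize_inf, realize_iInf, realize_isPowFormula, Ring.realize_add,
    Ring.realize_mul, Ring.realize_one, realize_ringTermPow, Term.realize_var, Sum.elim_inl,
    Sum.elim_inr, Subtype.forall, Prod.forall]

end Formula

/-! ### The valuation-theoretic content of the formula -/

section Valued

variable {K Γ₀ : Type*} [Field K] [LinearOrderedCommGroupWithZero Γ₀] {v : Valuation K Γ₀} {p : ℕ}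

/-- The residue class of an element of value at most one. -/
noncomputable abbrev residueOf (v : Valuation K Γ₀) (a : K) (ha : v a ≤ 1) : residueFieldOf v :=
  IsLocalRing.residue v.valuationSubring ⟨a, (v.mem_valuationSubring_iff a).2 ha⟩

theorem residueOf_eq_zero_iff {a : K} (ha : v a ≤ 1) : residueOf v a ha = 0 ↔ v a < 1 := by
  rw [residueOf, IsLocalRing.residue_eq_zero_iff, ValuationSubring.valuation_lt_one_iff]
  exact (v.isEquiv_valuation_valuationSubring.lt_one_iff_lt_one).symm

theorem residueOf_mul {a b : K} (ha : v a ≤ 1) (hb : v b ≤ 1) (hab : v (a * b) ≤ 1) :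
    residueOf v (a * b) hab = residueOf v a ha * residueOf v b hb := by
  rw [residueOf, residueOf, residueOf, ← map_mul]; rfl

theorem residueOf_pow {a : K} (ha : v a ≤ 1) (k : ℕ) (hk : v (a ^ k) ≤ 1) :
    residueOf v (a ^ k) hk = residueOf v a ha ^ k := by
  rw [residueOf, residueOf, ← map_pow]; rfl

theorem residueOf_surjective (r : residueFieldOf v) : ∃ a, ∃ ha : v a ≤ 1, residueOf v a ha = r := by
  obtain ⟨⟨a, ha⟩, h⟩ := IsLocalRing.residue_surjective r
  exact ⟨a, ha, h⟩

theorem residueOf_eq_iff {a b : K} (ha : v a ≤ 1) (hb : v b ≤ 1) :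
    residueOf v a ha = residueOf v b hb ↔ v (a - b) < 1 := by
  have hab : v (a - b) ≤ 1 := (v.map_sub a b).trans (max_le ha hb)
  rw [← residueOf_eq_zero_iff hab, ← sub_eq_zero, residueOf, residueOf, residueOf, ← map_sub]
  rfl

/-- If all one-units are `p`-th powers, then so is every unit whose residue is a `p`-th power. -/
theorem exists_pow_eq_of_residueOf (hp : p ≠ 0) (H : ∀ a, v a < 1 → ∃ y : K, y ^ p = 1 + a) {a : K}
    (ha : v a = 1) (r : residueFieldOf v) (hr : r ^ p = residueOf v a ha.le) :
    ∃ y : K, y ^ p = a := by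
  obtain ⟨b, hb, rfl⟩ := residueOf_surjective r
  have hb1 : v b = 1 := by
    refine hb.eq_of_not_lt fun hlt => ?_
    rw [(residueOf_eq_zero_iff hb).2 hlt, zero_pow hp, eq_comm, residueOf_eq_zero_iff] at hr
    exact hr.ne ha
  have hbp : v (b ^ p) ≤ 1 := by rw [map_pow, hb1, one_pow]
  have hb0 : b ≠ 0 := by rintro rfl; simp at hb1
  rw [← residueOf_pow hb p hbp, eq_comm, residueOf_eq_iff] at hr
  obtain ⟨y, hy⟩ := H ((a - b ^ p) / b ^ p) (by rwa [map_div₀, map_pow, hb1, one_pow, div_one])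
  refine ⟨y * b, ?_⟩
  rw [mul_pow, hy]
  field_simp
  ring

theorem exists_pow_eq_of_pow_pred {F : Type*} [Field F] (hp : 0 < p) {w y : F}
    (hw : w ≠ 0) (h : y ^ p = w ^ (p - 1)) : ∃ z : F, z ^ p = w := by
  have hy : y ^ p ≠ 0 := h ▸ pow_ne_zero _ hw
  refine ⟨w / y, ?_⟩
  rw [div_pow, div_eq_iff hy, h, ← pow_succ', Nat.sub_add_cancel hp]

/-- If `v w > 1`, then `1 + w = w * (1 + w⁻¹)` makes `w` a power. If `v w < 1`, then `x ^ p * w ^ p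
+ w ^ (p - 1) = w ^ (p - 1) * (1 + x ^ p * w)` makes `w ^ (p - 1)`, hence `w`, a power. -/
theorem valuation_eq_one_of_pow (hp : 0 < p) (H : ∀ a, v a < 1 → ∃ y : K, y ^ p = 1 + a) {x w : K}
    (hx : v x ≤ 1) (hw : ¬ ∃ y : K, y ^ p = w) (h1 : ∃ y : K, y ^ p = 1 + w)
    (h2 : ∃ y : K, y ^ p = x ^ p * w ^ p + w ^ (p - 1)) : v w = 1 := by
  have hw0 : w ≠ 0 := fun h => hw ⟨0, by rw [h, zero_pow hp.ne']⟩
  have hunit : ∀ a y : K, v a < 1 → y ^ p = 1 + a → y ^ p ≠ 0 := by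
    intro a y ha hy h0
    have := v.map_one_add_of_lt ha
    rw [← hy, h0, map_zero] at this
    exact zero_ne_one this
  apply le_antisymm
  · by_contra! hlt
    have hlt' : v w⁻¹ < 1 := by rw [map_inv₀]; exact inv_lt_one_of_one_lt₀ hlt
    obtain ⟨y, hy⟩ := H _ hlt'
    obtain ⟨z, hz⟩ := h1
    refine hw ⟨z / y, ?_⟩
    rw [div_pow, div_eq_iff (hunit _ _ hlt' hy), hz, hy]
    field_simp
    ring
  · by_contra! hlt
    have hlt' : v (x ^ p * w) < 1 := by
      rw [map_mul, map_pow]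
      exact (mul_le_of_le_one_left' (pow_le_one' hx p)).trans_lt hlt
    obtain ⟨y, hy⟩ := H _ hlt'
    obtain ⟨z, hz⟩ := h2
    apply hw
    apply exists_pow_eq_of_pow_pred hp hw0 (y := z / y)
    rw [div_pow, div_eq_iff (hunit _ _ hlt' hy), hz, hy]
    have hwp : w ^ p = w ^ (p - 1) * w := by rw [← pow_succ, Nat.sub_add_cancel hp]
    rw [hwp]
    ring

/-- The power classes of a field: units modulo `p`-th powers. -/
abbrev PowerClasses (p : ℕ) (F : Type*) [Field F] : Type _ :=
  Fˣ ⧸ (powMonoidHom p : Fˣ →* Fˣ).range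

/-- The exponent `p - 1` stands in for an inverse modulo `p`-th powers, which keeps the condition
polynomial, as the formula requires. -/
theorem powerClasses_mk_eq_iff (hp : 0 < p) {F : Type*} [Field F] (a b : Fˣ) :
    (QuotientGroup.mk a : PowerClasses p F) = QuotientGroup.mk b ↔
      ∃ r : F, r ^ p = b * a ^ (p - 1) := by
  rw [QuotientGroup.eq]
  constructor
  · rintro ⟨r, hr⟩
    refine ⟨(r * a : Fˣ), ?_⟩
    have : (r * a) ^ p = b * a ^ (p - 1) := by
      rw [powMonoidHom_apply] at hr
      have hap : a ^ p = a ^ (p - 1) * a := by rw [← pow_succ, Nat.sub_add_cancel hp]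
      rw [mul_pow, hr, hap, mul_comm _ a, ← mul_assoc, mul_right_comm a⁻¹, inv_mul_cancel, one_mul]
    exact_mod_cast congrArg Units.val this
  · rintro ⟨r, hr⟩
    have hr0 : r ≠ 0 := by
      rintro rfl
      rw [zero_pow hp.ne', eq_comm] at hr
      exact (b * a ^ (p - 1)).ne_zero (by exact_mod_cast hr)
    refine ⟨Units.mk0 r hr0 * a⁻¹, ?_⟩
    ext
    have ha : (a : F) ^ p = a ^ (p - 1) * a := by rw [← pow_succ, Nat.sub_add_cancel hp]
    simp only [powMonoidHom_apply, Units.val_pow_eq_pow_val, Units.val_mul, Units.val_mk0,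
      Units.val_inv_eq_inv_val, mul_pow, hr, inv_pow, ha]
    field_simp

theorem not_exists_independent_units (hp : 0 < p) (H : ∀ a, v a < 1 → ∃ y : K, y ^ p = 1 + a)
    {M : ℕ} (hM : 0 < M) (hcard : Nat.card (PowerClasses p (residueFieldOf v)) = M) {w : Fin M → K}
    (hw1 : ∀ i, v (w i) = 1) (hw : ∀ i, ¬ ∃ y : K, y ^ p = w i)
    (hww : ∀ i j, i ≠ j → ¬ ∃ y : K, y ^ p = w i * w j ^ (p - 1)) : False := by
  have hu0 : ∀ i, residueOf v (w i) (hw1 i).le ≠ 0 := fun i h =>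
    ((residueOf_eq_zero_iff _).1 h).ne (hw1 i)
  let u : Fin M → (residueFieldOf v)ˣ := fun i => Units.mk0 _ (hu0 i)
  -- The value `none` supplies the trivial class, giving `M + 1` distinct classes among `M`.
  let f : Option (Fin M) → PowerClasses p (residueFieldOf v) := fun o =>
    o.elim (QuotientGroup.mk 1) fun i => QuotientGroup.mk (u i)
  have h1 : ∀ i, (QuotientGroup.mk 1 : PowerClasses p (residueFieldOf v)) ≠
      QuotientGroup.mk (u i) := by
    intro i h
    obtain ⟨r, hr⟩ := (powerClasses_mk_eq_iff hp _ _).1 h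
    simp only [Units.val_one, one_pow, mul_one] at hr
    exact hw i (exists_pow_eq_of_residueOf hp.ne' H (hw1 i) r hr)
  have h2 : ∀ i j, i ≠ j → (QuotientGroup.mk (u j) : PowerClasses p (residueFieldOf v)) ≠
      QuotientGroup.mk (u i) := by
    intro i j hij h
    obtain ⟨r, hr⟩ := (powerClasses_mk_eq_iff hp _ _).1 h
    have hv : v (w i * w j ^ (p - 1)) = 1 := by rw [map_mul, map_pow, hw1, hw1, one_pow, one_mul]
    refine hww i j hij (exists_pow_eq_of_residueOf hp.ne' H hv r ?_)
    rw [residueOf_mul (hw1 i).le (by rw [map_pow, hw1, one_pow]), residueOf_pow (hw1 j).le]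
    exact hr
  have hf : Function.Injective f := by
    rintro (_ | i) (_ | j) h
    · rfl
    · exact (h1 j h).elim
    · exact (h1 i h.symm).elim
    · by_contra hij
      exact h2 j i (fun e => hij (by rw [e])) h
  -- `Nat.card` is `0` on infinite types, so a positive value yields finiteness.
  have : Finite (PowerClasses p (residueFieldOf v)) :=
    Nat.finite_of_card_ne_zero (by rw [hcard]; exact hM.ne')
  have := Nat.card_le_card_of_injective f hf
  rw [hcard, Nat.card_eq_fintype_card, Fintype.card_option, Fintype.card_fin] at this
  omega

/-! ### Witnesses for non-integral elements. -/

/-- If the value group has no nontrivial `p`-divisible convex subgroup, then some value that is not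
divisible by `p` lies strictly between the values of `(x ^ p)⁻¹` and `1`. -/
theorem exists_value_not_pow_between (hp : 0 < p) (hΓ : NoPDivisibleConvexSubgroup p (valueGroupOf v))
    {x : K} (hx : 1 < v x) :
    ∃ y : K, (∀ z : K, v z ^ p ≠ v y) ∧ v y < 1 ∧ 1 < v (x ^ p * y) := by
  have hx0 : x ≠ 0 := by rintro rfl; simp at hx
  have hvx0 : v x ≠ 0 := (v.ne_zero_iff).2 hx0
  let ξ : valueGroupOf v := ⟨Units.mk0 (v x) hvx0, MonoidWithZeroHom.mem_valueGroup _ ⟨x, rfl⟩⟩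
  have hξ : 1 < ξ := by
    change (1 : Γ₀) < v x
    exact hx
  -- The convex subgroup generated by `ξ`; being nontrivial, it is not `p`-divisible.
  let H : Subgroup (valueGroupOf v) :=
    { carrier := {g | ∃ k : ℕ, (ξ ^ k)⁻¹ ≤ g ∧ g ≤ ξ ^ k}
      mul_mem' := by
        rintro a b ⟨k, h1, h2⟩ ⟨l, h3, h4⟩
        refine ⟨k + l, ?_, ?_⟩
        · rw [pow_add, mul_inv]; exact mul_le_mul' h1 h3
        · rw [pow_add]; exact mul_le_mul' h2 h4
      one_mem' := ⟨0, by simp, by simp⟩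
      inv_mem' := by
        rintro a ⟨k, h1, h2⟩
        exact ⟨k, inv_le_inv' h2, inv_le'.1 h1⟩ }
  have hHconv : (H : Set (valueGroupOf v)).OrdConnected := by
    refine ⟨?_⟩
    rintro a ⟨k, h1, -⟩ b ⟨l, -, h4⟩ c ⟨hac, hcb⟩
    refine ⟨k + l, ?_, ?_⟩
    · refine le_trans ?_ (h1.trans hac)
      exact inv_le_inv' (pow_le_pow_right' hξ.le (Nat.le_add_right _ _))
    · exact (hcb.trans h4).trans (pow_le_pow_right' hξ.le (Nat.le_add_left _ _))
  have hξH : ξ ∈ H := ⟨1, by rw [pow_one]; exact (inv_le_one'.2 hξ.le).trans hξ.le, by simp⟩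
  have hH : ¬ ∀ h ∈ H, ∃ g ∈ H, g ^ p = h := by
    intro h
    have := hΓ H hHconv h
    rw [this, Subgroup.mem_bot] at hξH
    exact hξ.ne' hξH
  push Not at hH
  obtain ⟨h, ⟨k, hk1, hk2⟩, hh⟩ := hH
  -- A `p`-th root of `h` lies between `h` and `1`, hence in `H`; so `h` has no root in the whole
  -- group either.
  have hh' : ∀ g : valueGroupOf v, g ^ p ≠ h := by
    intro g hg
    refine hh g ⟨k, ?_, ?_⟩ hg
    · rcases le_total g 1 with h1 | h1
      · refine hk1.trans (hg ▸ ?_)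
        exact (pow_le_pow_right_of_le_one' h1 hp).trans_eq (pow_one g)
      · exact (inv_le_one'.2 (one_le_pow_of_one_le' hξ.le k)).trans h1
    · rcases le_total g 1 with h1 | h1
      · exact h1.trans (one_le_pow_of_one_le' hξ.le k)
      · refine le_trans (hg ▸ ?_) hk2
        exact (pow_one g).symm.trans_le (pow_le_pow_right' h1 hp)
  obtain ⟨y₀, hy₀⟩ : ∃ y₀ : K, v y₀ = (h : Γ₀ˣ) := by
    obtain ⟨a, ha, b, hab⟩ := (MonoidWithZeroHom.mem_valueGroup_iff_of_comm _).1 h.2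
    refine ⟨b / a, ?_⟩
    rw [map_div₀, div_eq_iff]
    · rw [mul_comm]; exact hab.symm
    · exact ha
  have hpow : ∀ m : ℕ, h * (ξ ^ p) ^ k ≠ (ξ ^ p) ^ m := by
    intro m hm
    apply hh' (ξ ^ m * (ξ ^ k)⁻¹)
    rw [mul_pow, inv_pow, ← pow_mul, ← pow_mul, mul_inv_eq_iff_eq_mul]
    rw [← pow_mul, ← pow_mul] at hm
    rw [mul_comm m, mul_comm k, hm]
  have hξp : ξ ≤ ξ ^ p := (pow_one ξ).symm.trans_le (pow_le_pow_right' hξ.le hp)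
  -- Shifting by powers of `ξ ^ p` preserves non-divisibility. The factor `(ξ ^ p) ^ k` lifts `h` to
  -- at least `1`, so the least such `m` is positive, and `hpow` makes the bounds on both sides
  -- strict.
  have hex : ∃ m : ℕ, h * (ξ ^ p) ^ k ≤ (ξ ^ p) ^ m := by
    refine ⟨k + k, ?_⟩
    rw [pow_add]
    exact mul_le_mul_left (hk2.trans (pow_le_pow_left' hξp k)) _
  classical
  obtain ⟨m, hm⟩ : ∃ m, Nat.find hex = m + 1 := by
    refine Nat.exists_eq_succ_of_ne_zero fun h0 => ?_
    have h1 := (Nat.find_spec hex).lt_of_ne (hpow _)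
    rw [h0, pow_zero] at h1
    refine absurd h1 (not_lt.2 ?_)
    refine le_trans ?_ (mul_le_mul_left hk1 _)
    rw [← div_eq_inv_mul, one_le_div']
    exact pow_le_pow_left' hξp k
  have hlt := (Nat.find_spec hex).lt_of_ne (hpow _)
  have hgt := not_le.1 (Nat.find_min hex (m := m) (by omega))
  rw [hm] at hlt
  have hlt' : v y₀ * (v x ^ p) ^ k < (v x ^ p) ^ (m + 1) := by rw [hy₀]; exact hlt
  have hgt' : (v x ^ p) ^ m < v y₀ * (v x ^ p) ^ k := by rw [hy₀]; exact hgt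
  have hpos : ∀ j, 0 < (v x ^ p) ^ j := fun j =>
    zero_lt_iff.2 (pow_ne_zero _ (pow_ne_zero _ hvx0))
  refine ⟨y₀ * (x ^ p) ^ k / (x ^ p) ^ (m + 1), fun z hz => ?_, ?_, ?_⟩
  · have hz' : v (z * x ^ (m + 1) / x ^ k) ^ p = (h : Γ₀ˣ) := by
      rw [← hy₀]
      simp only [map_div₀, map_mul, map_pow] at hz ⊢
      rw [div_pow, mul_pow, hz, ← pow_mul, ← pow_mul, ← pow_mul, ← pow_mul, mul_comm p, mul_comm p]
      field_simp
    have hne : v (z * x ^ (m + 1) / x ^ k) ≠ 0 := by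
      intro h0
      rw [h0, zero_pow hp.ne'] at hz'
      exact (h : Γ₀ˣ).ne_zero hz'.symm
    refine hh' ⟨Units.mk0 _ hne, MonoidWithZeroHom.mem_valueGroup _ ⟨_, rfl⟩⟩ ?_
    ext
    simpa using hz'
  · simp only [map_div₀, map_mul, map_pow]
    exact (div_lt_one₀ (hpos _)).2 hlt'
  · simp only [map_div₀, map_mul, map_pow]
    rw [pow_succ (v x ^ p) m, ← mul_div_assoc, mul_comm (v x ^ p), mul_div_mul_right _ _
      (pow_ne_zero _ hvx0)]
    exact (one_lt_div₀ (hpos _)).2 hgt'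

theorem exists_independent_of_one_lt (hp : 0 < p) (H : ∀ a, v a < 1 → ∃ y : K, y ^ p = 1 + a)
    {M : ℕ} (hM : 0 < M) (hcard : Nat.card (PowerClasses p (residueFieldOf v)) = M)
    (hΓ : NoPDivisibleConvexSubgroup p (valueGroupOf v)) {x : K} (hx : 1 < v x) :
    ∃ w : Fin M → K, (∀ i, ¬ ∃ y : K, y ^ p = w i) ∧
      (∀ i j, i ≠ j → ¬ ∃ y : K, y ^ p = w i * w j ^ (p - 1)) ∧
      (∀ i, ∃ y : K, y ^ p = 1 + w i) ∧
      ∀ i, ∃ y : K, y ^ p = x ^ p * w i ^ p + w i ^ (p - 1) := by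
  obtain ⟨y, hy, hy1, hxy⟩ := exists_value_not_pow_between hp hΓ hx
  have : Finite (PowerClasses p (residueFieldOf v)) :=
    Nat.finite_of_card_ne_zero (by rw [hcard]; exact hM.ne')
  let e := Finite.equivFinOfCardEq hcard
  have hex : ∀ i : Fin M, ∃ (u : K) (r : (residueFieldOf v)ˣ) (hu : v u = 1),
      residueOf v u hu.le = r ∧ (QuotientGroup.mk r : PowerClasses p (residueFieldOf v)) =
        e.symm i := by
    intro i
    obtain ⟨r, hr⟩ := QuotientGroup.mk_surjective (e.symm i)
    obtain ⟨u, hu, hur⟩ := residueOf_surjective (v := v) r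
    refine ⟨u, r, hu.eq_of_not_lt fun hlt => ?_, hur, hr⟩
    rw [(residueOf_eq_zero_iff hu).2 hlt] at hur
    exact r.ne_zero hur.symm
  choose u r hu hur hr using hex
  have hvw : ∀ i, v (u i * y) = v y := fun i => by rw [map_mul, hu, one_mul]
  have hy0 : y ≠ 0 := by
    rintro rfl
    exact hy 0 (by rw [map_zero, zero_pow hp.ne'])
  have hx0 : x ≠ 0 := by rintro rfl; simp at hx
  have hu0 : ∀ i, u i ≠ 0 := by
    intro i h
    have := hu i
    rw [h, map_zero] at this
    exact zero_ne_one this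
  refine ⟨fun i => u i * y, ?_, ?_, ?_, ?_⟩
  · rintro i ⟨z, hz⟩
    exact hy z (by rw [← map_pow, hz, hvw])
  · rintro i j hij ⟨z, hz⟩
    have hyp : y ^ p = y ^ (p - 1) * y := by rw [← pow_succ, Nat.sub_add_cancel hp]
    -- In `w i * w j ^ (p - 1)` the factor `y` occurs to the power `p` and cancels.
    have hz' : (z / y) ^ p = u i * u j ^ (p - 1) := by
      rw [div_pow, hz, hyp, mul_pow]
      field_simp
    have hv1 : v ((z / y) ^ p) = 1 := by
      rw [hz', map_mul, map_pow, hu, hu, one_pow, one_mul]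
    have hv2 : v (z / y) ≤ 1 := by
      rw [map_pow] at hv1
      by_contra! hlt
      exact (one_lt_pow₀ hlt hp.ne').ne' hv1
    apply hij
    apply e.symm.injective
    rw [← hr, ← hr, eq_comm, powerClasses_mk_eq_iff hp]
    refine ⟨residueOf v (z / y) hv2, ?_⟩
    rw [← residueOf_pow hv2 p hv1.le, ← hur, ← hur,
      ← residueOf_pow (hu j).le _ (by rw [map_pow, hu, one_pow]),
      ← residueOf_mul _ _ (by rw [← hz', hv1])]
    congr 2
  · exact fun i => H _ (by rw [hvw]; exact hy1)
  · intro i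
    -- With `w = u i * y`, the sum equals `(x * w) ^ p * (1 + (x ^ p * w)⁻¹)`.
    have hlt : v (x ^ p * (u i * y))⁻¹ < 1 := by
      rw [map_inv₀]
      apply inv_lt_one_of_one_lt₀
      rwa [map_mul, hvw, ← map_mul]
    obtain ⟨z, hz⟩ := H _ hlt
    refine ⟨x * (u i * y) * z, ?_⟩
    have hwp : (u i * y) ^ p = (u i * y) ^ (p - 1) * (u i * y) := by
      rw [← pow_succ, Nat.sub_add_cancel hp]
    have := hu0 i
    rw [mul_pow, mul_pow x, hz, hwp]
    field_simp

theorem mem_valuationSubring_iff_forall_not (hp : 0 < p)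
    (H : ∀ a, v a < 1 → ∃ y : K, y ^ p = 1 + a)
    {M : ℕ} (hM : 0 < M) (hcard : Nat.card (PowerClasses p (residueFieldOf v)) = M)
    (hΓ : NoPDivisibleConvexSubgroup p (valueGroupOf v)) (x : K) :
    x ∈ v.valuationSubring ↔ ∀ w : Fin M → K,
      ¬ ((∀ i, ¬ ∃ y : K, y ^ p = w i) ∧
        (∀ i j, i ≠ j → ¬ ∃ y : K, y ^ p = w i * w j ^ (p - 1)) ∧
        (∀ i, ∃ y : K, y ^ p = 1 + w i) ∧
        ∀ i, ∃ y : K, y ^ p = x ^ p * w i ^ p + w i ^ (p - 1)) := by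
  rw [Valuation.mem_valuationSubring_iff]
  constructor
  · rintro hx w ⟨h1, h2, h3, h4⟩
    exact not_exists_independent_units hp H hM hcard
      (fun i => valuation_eq_one_of_pow hp H hx (h1 i) (h3 i) (h4 i)) h1 h2
  · intro h
    by_contra! hx
    obtain ⟨w, hw⟩ := exists_independent_of_one_lt hp H hM hcard hΓ hx
    exact h w hw

end Valued

/-! ### One-units of henselian and `p`-henselian valuations -/

section Henselian

open Polynomial

variable {K Γ₀ : Type*} [Field K] [LinearOrderedCommGroupWithZero Γ₀] {v : Valuation K Γ₀} {p : ℕ}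

theorem valuation_natCast_eq_one (hp : p.Prime) (hF : ¬ CharP (residueFieldOf v) p) :
    v (p : K) = 1 := by
  have hle : v (p : K) ≤ 1 := (natCast_mem v.valuationSubring p : _)
  refine hle.eq_of_not_lt fun hlt => hF ?_
  rw [CharP.charP_iff_prime_eq_zero hp, ← (residueOf_eq_zero_iff hle).2 hlt, residueOf,
    ← map_natCast (IsLocalRing.residue v.valuationSubring)]
  rfl

theorem natCast_ne_zero_of_residueField (hp : p.Prime) (hF : ¬ CharP (residueFieldOf v) p) :
    (p : K) ≠ 0 := fun h => by
  have := valuation_natCast_eq_one hp hF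
  rw [h, map_zero] at this
  exact zero_ne_one this

section Extension

variable {L : Type*} [Field L] [Algebra K L] {B : ValuationSubring L}

theorem valuation_algebraMap_lt_one_iff
    (hB : B.comap (algebraMap K L) = v.valuationSubring) (x : K) :
    B.valuation (algebraMap K L x) < 1 ↔ v x < 1 := by
  have : (B.valuation.comap (algebraMap K L)).IsEquiv v := by
    rw [Valuation.isEquiv_iff_valuationSubring, ← hB]
    ext y
    simp [ValuationSubring.mem_comap]
  exact this.lt_one_iff_lt_one (x := x)

/-- The pullback of `B` along `σ` again extends `v`, so uniqueness identifies it with `B`. -/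
theorem valuation_algEquiv_lt_one_iff (hv : HasUniqueExtension v L)
    (hB : B.comap (algebraMap K L) = v.valuationSubring) (σ : Gal(L/K)) (x : L) :
    B.valuation (σ x) < 1 ↔ B.valuation x < 1 := by
  have hσ : B.comap (σ : L →+* L) = B := by
    refine hv.unique ?_ hB
    rw [ValuationSubring.comap_comap, ← hB]
    congr 1
    ext y
    simp
  have : (B.valuation.comap (σ : L →+* L)).IsEquiv B.valuation := by
    rw [Valuation.isEquiv_iff_valuationSubring]
    ext y
    rw [Valuation.mem_valuationSubring_iff, Valuation.mem_valuationSubring_iff,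
      Valuation.comap_apply, ValuationSubring.valuation_le_one_iff,
      ValuationSubring.valuation_le_one_iff]
    nth_rewrite 2 [← hσ]
    rw [ValuationSubring.mem_comap]
  exact this.lt_one_iff_lt_one (x := x)

/-- Among the `p`-th roots of a one-unit, one is congruent to `1`, up to a root of unity. -/
theorem exists_rootOfUnity_congruent (hp : p.Prime) {ζ : K} (hζ : IsPrimitiveRoot ζ p)
    (w : Valuation L Γ₀) {α : L} (hα : w (α ^ p - 1) < 1) :
    ∃ η : K, η ^ p = 1 ∧ w (α - algebraMap K L η) < 1 := by
  have : NeZero p := ⟨hp.ne_zero⟩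
  have hζL := hζ.map_of_injective (algebraMap K L).injective
  by_contra! h
  refine hα.not_ge ?_
  have := hζL.pow_sub_pow_eq_prod_sub_mul α 1 hp.pos
  rw [one_pow] at this
  rw [this, map_prod]
  apply Finset.one_le_prod'
  intro μ hμ
  obtain ⟨i, -, rfl⟩ := hζL.eq_pow_of_pow_eq_one ((mem_nthRootsFinset hp.pos 1).1 hμ)
  rw [mul_one, ← map_pow]
  exact h _ (by rw [← pow_mul, mul_comm, pow_mul, hζ.pow_eq_one, one_pow])

/-- Since `1 + ε + ⋯ + ε ^ (p - 1) = 0`, the number `p` is minus the sum of the `ε ^ i - 1`, each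
divisible by `ε - 1`. -/
theorem valuation_natCast_lt_one_of_rootOfUnity (w : Valuation L Γ₀) {ε : L}
    (hε : ε ^ p = 1) (hε1 : ε ≠ 1) (hw : w (ε - 1) < 1) : w (p : L) < 1 := by
  have hεw : w ε ≤ 1 := by
    have := w.map_add (ε - 1) 1
    rw [sub_add_cancel, map_one] at this
    exact this.trans (max_le hw.le le_rfl)
  have hgeom : ∑ i ∈ Finset.range p, ε ^ i = 0 := by
    have := geom_sum_mul ε p
    rw [hε, sub_self] at this
    exact (mul_eq_zero.1 this).resolve_right (sub_ne_zero.2 hε1)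
  have hsum : (p : L) = - ∑ i ∈ Finset.range p, (ε ^ i - 1) := by
    rw [Finset.sum_sub_distrib, hgeom]
    simp
  rw [hsum, Valuation.map_neg]
  refine w.map_sum_lt one_ne_zero fun i _ => ?_
  rw [← geom_sum_mul, map_mul]
  refine (mul_le_of_le_one_left' ?_).trans_lt hw
  refine w.map_sum_le fun j _ => ?_
  rw [map_pow]
  exact pow_le_one' hεw j

/-- Some root of unity `η` in `K` is congruent to `α`, hence also to `σ α`. If `σ α ≠ α`, the
quotient `σ α / α` is a nontrivial `p`-th root of unity congruent to `1`, which forces residue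
characteristic `p`. -/
theorem exists_pow_eq_of_hasUniqueExtension (hp : p.Prime) {ζ : K} (hζ : IsPrimitiveRoot ζ p)
    (hF : ¬ CharP (residueFieldOf v) p) (hv : HasUniqueExtension v L) {a : K} (ha : v a < 1) {α : L}
    (hα : α ^ p = algebraMap K L (1 + a))
    (hfix : (∀ σ : Gal(L/K), σ α = α) → ∃ y : K, algebraMap K L y = α) :
    ∃ y : K, y ^ p = 1 + a := by
  by_cases hσ : ∀ σ : Gal(L/K), σ α = α
  · obtain ⟨y, hy⟩ := hfix hσ
    refine ⟨y, (algebraMap K L).injective ?_⟩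
    rw [map_pow, hy, hα]
  exfalso
  push Not at hσ
  obtain ⟨σ, hσ⟩ := hσ
  obtain ⟨B, hB, -⟩ := id hv
  have hα1 : B.valuation (α ^ p - 1) < 1 := by
    rw [hα, map_add, map_one, add_sub_cancel_left, valuation_algebraMap_lt_one_iff hB]
    exact ha
  obtain ⟨η, hη, hη1⟩ := exists_rootOfUnity_congruent hp hζ B.valuation hα1
  have hση : B.valuation (σ α - algebraMap K L η) < 1 := by
    rw [← σ.commutes η, ← map_sub, valuation_algEquiv_lt_one_iff hv hB]
    exact hη1
  have hdiff : B.valuation (σ α - α) < 1 := by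
    have := B.valuation.map_sub (σ α - algebraMap K L η) (α - algebraMap K L η)
    rw [sub_sub_sub_cancel_right] at this
    exact this.trans_lt (max_lt hση hη1)
  have hαp : B.valuation α ^ p = 1 := by
    have := B.valuation.map_one_add_of_lt hα1
    rwa [add_sub_cancel, map_pow] at this
  have hαv : B.valuation α = 1 := by
    rcases lt_trichotomy (B.valuation α) 1 with h | h | h
    · exact absurd hαp (pow_lt_one₀ zero_le h hp.ne_zero).ne
    · exact h
    · exact absurd hαp (one_lt_pow₀ h hp.ne_zero).ne'
  have hα0 : α ≠ 0 := by rintro rfl; simp at hαv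
  have hlt := valuation_natCast_lt_one_of_rootOfUnity (p := p) B.valuation (ε := σ α / α)
    (by rw [div_pow, ← map_pow, hα, σ.commutes, ← hα, div_self (pow_ne_zero _ hα0)])
    (fun h => hσ ((div_eq_one_iff_eq hα0).1 h))
    (by rwa [div_sub_one hα0, map_div₀, hαv, div_one])
  rw [← map_natCast (algebraMap K L), valuation_algebraMap_lt_one_iff hB,
    valuation_natCast_eq_one hp hF] at hlt
  exact lt_irrefl _ hlt

end Extension

/-! ### Kummer extensions inside `K(p)`. -/

instance isGalois_maximalProPExtension (p : ℕ) (K : Type*) [Field K] :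
    IsGalois K (maximalProPExtension p K) := by
  have hgal : ∀ L ∈ {L : IntermediateField K (AlgebraicClosure K) |
      FiniteDimensional K L ∧ IsGalois K L ∧ ∃ k : ℕ, Module.finrank K L = p ^ k}, IsGalois K L :=
    fun L hL => hL.2.1
  unfold maximalProPExtension
  rw [iSup_subtype']
  have hn : ∀ L : {L : IntermediateField K (AlgebraicClosure K) |
      FiniteDimensional K L ∧ IsGalois K L ∧ ∃ k : ℕ, Module.finrank K L = p ^ k},
      Normal K (L : IntermediateField K (AlgebraicClosure K)) := fun L => (hgal L L.2).to_normal
  have hs : ∀ L : {L : IntermediateField K (AlgebraicClosure K) |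
      FiniteDimensional K L ∧ IsGalois K L ∧ ∃ k : ℕ, Module.finrank K L = p ^ k},
      Algebra.IsSeparable K (L : IntermediateField K (AlgebraicClosure K)) :=
    fun L => (hgal L L.2).to_isSeparable
  exact { to_isSeparable := IntermediateField.isSeparable_iSup (h := hs)
          to_normal := IntermediateField.normal_iSup K _ _ }

theorem exists_root_mem_maximalProPExtension (hp : p.Prime) {ζ : K} (hζ : IsPrimitiveRoot ζ p)
    {a : K} (ha : ∀ b : K, b ^ p ≠ a) :
    ∃ α : maximalProPExtension p K, α ^ p = algebraMap K _ a := by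
  have : NeZero p := ⟨hp.ne_zero⟩
  have hirr := X_pow_sub_C_irreducible_of_prime hp ha
  have hζ' : (primitiveRoots p K).Nonempty := ⟨ζ, (mem_primitiveRoots hp.pos).2 hζ⟩
  have hsplit : ((X ^ p - C a).map (algebraMap K (AlgebraicClosure K))).Splits :=
    IsAlgClosed.splits _
  let E := IntermediateField.adjoin K ((X ^ p - C a).rootSet (AlgebraicClosure K))
  have hE : IsSplittingField K E (X ^ p - C a) :=
    IntermediateField.adjoin_rootSet_isSplittingField hsplit
  have hmem : E ∈ {L : IntermediateField K (AlgebraicClosure K) |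
      FiniteDimensional K L ∧ IsGalois K L ∧ ∃ k : ℕ, Module.finrank K L = p ^ k} :=
    ⟨IsSplittingField.finiteDimensional E (X ^ p - C a),
      isGalois_of_isSplittingField_X_pow_sub_C hζ' hirr E,
      1, by rw [pow_one]; exact finrank_of_isSplittingField_X_pow_sub_C hζ' hirr E⟩
  have hle : E ≤ maximalProPExtension p K := le_iSup₂_of_le E hmem le_rfl
  obtain ⟨α, hα⟩ := IsAlgClosed.exists_pow_nat_eq (algebraMap K (AlgebraicClosure K) a) hp.pos
  have hαE : α ∈ E := by
    apply IntermediateField.subset_adjoin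
    rw [mem_rootSet_of_ne (X_pow_sub_C_ne_zero hp.pos a)]
    simp [hα]
  exact ⟨⟨α, hle hαE⟩, Subtype.ext hα⟩

theorem exists_pow_eq_of_isPHenselianValuation (hp : p.Prime) {ζ : K} (hζ : IsPrimitiveRoot ζ p)
    (hF : ¬ CharP (residueFieldOf v) p) (hv : IsPHenselianValuation p v) {a : K} (ha : v a < 1) :
    ∃ y : K, y ^ p = 1 + a := by
  by_contra! h
  obtain ⟨α, hα⟩ := exists_root_mem_maximalProPExtension hp hζ h
  obtain ⟨y, hy⟩ := exists_pow_eq_of_hasUniqueExtension hp hζ hF hv ha hα fun hσ =>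
    IntermediateField.mem_bot.1 ((InfiniteGalois.mem_bot_iff_fixed α).2 hσ)
  exact h y hy

end Henselian

/-! ### Square classes of fields with absolute Galois group `Ẑ` -/

section Quadratic

open Polynomial

variable {F : Type*} [Field F]

/-- The base field may be imperfect, so Galois-fixed elements of the algebraic closure need not lie
in it. Automorphisms permute the roots of a minimal polynomial transitively, so a fixed element is
its only root. -/
theorem mem_perfectClosure_of_fixed {x : AlgebraicClosure F}
    (hx : ∀ σ : Gal(AlgebraicClosure F/F), σ x = x) : x ∈ perfectClosure F (AlgebraicClosure F) := by
  classical
  have hint : IsIntegral F x := Algebra.IsIntegral.isIntegral x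
  rw [mem_perfectClosure_iff_natSepDegree_eq_one,
    natSepDegree_eq_of_isAlgClosed (AlgebraicClosure F), Finset.card_eq_one]
  refine ⟨x, Finset.eq_singleton_iff_unique_mem.2 ⟨?_, fun y hy => ?_⟩⟩
  · rw [Multiset.mem_toFinset, mem_aroots]
    exact ⟨minpoly.ne_zero hint, minpoly.aeval F x⟩
  · rw [Multiset.mem_toFinset, mem_aroots] at hy
    obtain ⟨σ, rfl⟩ := minpoly.exists_algEquiv_of_root' hint.isAlgebraic hy.2
    exact hx σ

theorem odd_of_expChar (h2 : (2 : F) ≠ 0) (q : ℕ) [hq : ExpChar F q] : Odd q := by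
  cases hq with
  | zero => exact odd_one
  | prime hprime =>
    refine hprime.odd_of_ne_two ?_
    rintro rfl
    exact h2 (by exact_mod_cast CharP.cast_eq_zero F 2)

/-- An element of the algebraic closure fixed by all automorphisms has an odd power in the field. -/
theorem exists_odd_pow_mem_of_fixed (h2 : (2 : F) ≠ 0) {x : AlgebraicClosure F}
    (hx : ∀ σ : Gal(AlgebraicClosure F/F), σ x = x) :
    ∃ m : ℕ, Odd m ∧ ∃ d : F, algebraMap F (AlgebraicClosure F) d = x ^ m := by
  obtain ⟨n, d, hd⟩ := mem_perfectClosure_iff.1 (mem_perfectClosure_of_fixed hx)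
  exact ⟨_, (odd_of_expChar h2 (ringExpChar F)).pow, d, hd⟩

theorem exists_algebraMap_eq_of_fixed_of_sq (h2 : (2 : F) ≠ 0) {x : AlgebraicClosure F} {a : F}
    (ha : x ^ 2 = algebraMap F _ a) (hx : ∀ σ : Gal(AlgebraicClosure F/F), σ x = x) :
    ∃ y : F, algebraMap F (AlgebraicClosure F) y = x := by
  rcases eq_or_ne x 0 with rfl | hx0
  · exact ⟨0, map_zero _⟩
  obtain ⟨m, ⟨k, rfl⟩, d, hd⟩ := exists_odd_pow_mem_of_fixed h2 hx
  refine ⟨d / a ^ k, ?_⟩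
  -- Here `x = x ^ (2 * k + 1) / (x ^ 2) ^ k`.
  rw [map_div₀, map_pow, hd, ← ha, ← pow_mul, div_eq_iff (pow_ne_zero _ hx0), pow_succ, mul_comm]

theorem exists_sq_eq_of_isHenselianValuation {K Γ₀ : Type*} [Field K]
    [LinearOrderedCommGroupWithZero Γ₀] {v : Valuation K Γ₀} (hF : ¬ CharP (residueFieldOf v) 2)
    (hv : IsHenselianValuation v) {a : K} (ha : v a < 1) : ∃ y : K, y ^ 2 = 1 + a := by
  have h2 : (2 : K) ≠ 0 := by
    exact_mod_cast natCast_ne_zero_of_residueField Nat.prime_two hF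
  have hζ : IsPrimitiveRoot (-1 : K) 2 := by
    refine IsPrimitiveRoot.mk_of_lt _ two_pos (by norm_num) fun l h0 hl => ?_
    obtain rfl : l = 1 := by omega
    rw [pow_one]
    intro h
    apply h2
    linear_combination -h
  obtain ⟨α, hα⟩ := IsAlgClosed.exists_pow_nat_eq (algebraMap K (AlgebraicClosure K) (1 + a))
    two_pos
  exact exists_pow_eq_of_hasUniqueExtension Nat.prime_two hζ hF hv ha hα
    (exists_algebraMap_eq_of_fixed_of_sq h2 hα)

/-- Elements of `Ẑ` vanishing modulo two are divisible by two. -/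
theorem zHat_exists_add_self_eq (x : zHat) (hx : x.1 2 = 0) : ∃ y : zHat, y + y = x := by
  have hdvd : ∀ n : ℕ+, 2 ∣ (x.1 (2 * n)).val := by
    intro n
    have := x.2 2 (2 * n) ⟨n, by simp⟩
    rw [hx, ZMod.castHom_apply, ZMod.cast_eq_val] at this
    exact (ZMod.natCast_eq_zero_iff _ 2).1 this
  refine ⟨⟨fun n => (((x.1 (2 * n)).val / 2 : ℕ) : ZMod n), ?_⟩, ?_⟩
  · intro m n h
    have hmn : ((2 * m : ℕ+) : ℕ) ∣ ((2 * n : ℕ+) : ℕ) := by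
      rw [PNat.mul_coe, PNat.mul_coe]; exact Nat.mul_dvd_mul_left _ h
    have := x.2 (2 * m) (2 * n) hmn
    rw [map_natCast, ZMod.natCast_eq_natCast_iff]
    apply Nat.ModEq.mul_left_cancel' two_ne_zero
    rw [Nat.mul_div_cancel' (hdvd n), Nat.mul_div_cancel' (hdvd m)]
    rw [ZMod.castHom_apply, ZMod.cast_eq_val, ← ZMod.natCast_zmod_val (x.1 (2 * m)),
      ZMod.natCast_eq_natCast_iff] at this
    simpa using this
  · ext n
    change (((x.1 (2 * n)).val / 2 : ℕ) : ZMod n) + (((x.1 (2 * n)).val / 2 : ℕ) : ZMod n) = x.1 n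
    have hn : ((n : ℕ+) : ℕ) ∣ ((2 * n : ℕ+) : ℕ) := by
      rw [PNat.mul_coe]; exact Nat.dvd_mul_left _ _
    rw [← Nat.cast_add, ← two_mul, Nat.mul_div_cancel' (hdvd n), ← x.2 n (2 * n) hn,
      ZMod.castHom_apply, ZMod.cast_eq_val]

/-- Reduction modulo two on `Ẑ`. -/
def zHatModTwo : zHat →+ ZMod 2 :=
  (Pi.evalAddMonoidHom (fun n : ℕ+ => ZMod (n : ℕ)) 2).comp zHat.subtype

theorem continuous_zHatModTwo : Continuous zHatModTwo :=
  (continuous_apply (2 : ℕ+)).comp continuous_subtype_val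

theorem zHatModTwo_surjective : Function.Surjective zHatModTwo := by
  have h1 : (fun _ => 1 : ∀ n : ℕ+, ZMod (n : ℕ)) ∈ zHat := fun m n h => map_one _
  intro t
  fin_cases t
  · exact ⟨0, rfl⟩
  · exact ⟨⟨_, h1⟩, rfl⟩

/-! ### Quadratic characters and square classes. -/

/-- A group with a character to `ℤ/2` whose kernel consists of squares: the product of two nonsquares
of the field is a square. -/
theorem exists_sq_eq_mul_of_character (h2 : (2 : F) ≠ 0)
    (χ : Gal(AlgebraicClosure F/F) →* Multiplicative (ZMod 2))
    (hχ : ∀ σ, χ σ = 1 → ∃ τ, τ * τ = σ) {a b : F} (ha : ¬ ∃ y : F, y ^ 2 = a)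
    (hb : ¬ ∃ y : F, y ^ 2 = b) : ∃ y : F, y ^ 2 = a * b := by
  -- The sign by which the group acts on the root of any nonsquare is `χ` itself: it is trivial on
  -- squares, hence on the kernel of `χ`, but not trivial everywhere. For two nonsquares the signs
  -- therefore cancel.
  have key : ∀ c : F, (¬ ∃ y : F, y ^ 2 = c) → ∀ γ : AlgebraicClosure F,
      γ ^ 2 = algebraMap F _ c → ∀ σ : Gal(AlgebraicClosure F/F),
      σ γ = if χ σ = 1 then γ else -γ := by
    intro c hc γ hγ
    have hpm : ∀ σ : Gal(AlgebraicClosure F/F), σ γ = γ ∨ σ γ = -γ := fun σ => by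
      rw [← sq_eq_sq_iff_eq_or_eq_neg, ← map_pow, hγ, σ.commutes]
    have hker : ∀ σ : Gal(AlgebraicClosure F/F), χ σ = 1 → σ γ = γ := by
      intro σ hσ
      obtain ⟨τ, rfl⟩ := hχ σ hσ
      rw [AlgEquiv.mul_apply]
      rcases hpm τ with h | h
      · rw [h, h]
      · rw [h, map_neg, h, neg_neg]
    have hne : ∃ σ : Gal(AlgebraicClosure F/F), σ γ ≠ γ := by
      by_contra! hall
      obtain ⟨y, hy⟩ := exists_algebraMap_eq_of_fixed_of_sq h2 hγ hall
      refine hc ⟨y, (algebraMap F (AlgebraicClosure F)).injective ?_⟩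
      rw [map_pow, hy, hγ]
    obtain ⟨σ₀, hσ₀⟩ := hne
    intro σ
    split_ifs with h
    · exact hker σ h
    · have h0 : χ σ₀ ≠ 1 := fun h => hσ₀ (hker σ₀ h)
      have hmul : ∀ s t : Multiplicative (ZMod 2), s ≠ 1 → t ≠ 1 → s * t = 1 := by decide
      have hprod := hker (σ₀ * σ) (by rw [map_mul, hmul _ _ h0 h])
      rcases hpm σ with h' | h'
      · rw [AlgEquiv.mul_apply, h'] at hprod
        exact (hσ₀ hprod).elim
      · exact h'
  obtain ⟨α, hα⟩ := IsAlgClosed.exists_pow_nat_eq (algebraMap F (AlgebraicClosure F) a) two_pos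
  obtain ⟨β, hβ⟩ := IsAlgClosed.exists_pow_nat_eq (algebraMap F (AlgebraicClosure F) b) two_pos
  have hαβ : (α * β) ^ 2 = algebraMap F _ (a * b) := by rw [mul_pow, hα, hβ, map_mul]
  obtain ⟨y, hy⟩ := exists_algebraMap_eq_of_fixed_of_sq h2 hαβ fun σ => by
    rw [map_mul, key a ha α hα, key b hb β hβ]
    split_ifs <;> ring
  refine ⟨y, (algebraMap F (AlgebraicClosure F)).injective ?_⟩
  rw [map_pow, hy, hαβ]

/-- The sign in `ℤ` of an element of `ℤ/2`. -/
def signOfZModTwo : Multiplicative (ZMod 2) →* ℤ where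
  toFun t := if t = 1 then 1 else -1
  map_one' := rfl
  map_mul' := by decide

/-- The resolvent of a quadratic character of a finite group of automorphisms. -/
theorem exists_eigenvector_of_character {E : Type*} [Field E] [Algebra F E] [FiniteDimensional F E]
    (χ : Gal(E/F) →* ℤ) : ∃ α : E, α ≠ 0 ∧ ∀ σ : Gal(E/F), σ α = χ σ * α := by
  have hunit : ∀ σ, χ σ * χ σ = 1 := fun σ => by
    have h := Int.isUnit_iff.1 ((Group.isUnit σ).map χ)
    rcases h with h | h <;> rw [h] <;> rfl
  have hinj : Function.Injective fun σ : Gal(E/F) => (σ : E →* E) := by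
    intro σ τ h
    ext x
    exact DFunLike.congr_fun h x
  -- Dedekind independence of automorphisms makes some resolvent nonzero.
  have hlin := (linearIndependent_monoidHom E E).comp _ hinj
  rw [Fintype.linearIndependent_iff] at hlin
  have hex : ∃ x : E, ∑ σ : Gal(E/F), (χ σ : E) * σ x ≠ 0 := by
    by_contra! h
    have := hlin (fun σ => (χ σ : E)) (by
      ext x
      simpa [Finset.sum_apply] using h x) 1
    rw [map_one, Int.cast_one] at this
    exact one_ne_zero this
  obtain ⟨x, hx⟩ := hex
  refine ⟨_, hx, fun τ => ?_⟩
  rw [map_sum, Finset.mul_sum]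
  refine Fintype.sum_equiv (Equiv.mulLeft τ) _ _ fun σ => ?_
  rw [Equiv.coe_mulLeft, map_mul, map_mul, map_intCast, AlgEquiv.mul_apply, ← mul_assoc,
    Int.cast_mul, ← mul_assoc, ← Int.cast_mul, hunit, Int.cast_one, one_mul]

/-- An open kernel lets the character factor through a finite normal subextension, where the
resolvent applies. -/
theorem exists_eigenvector_of_continuous_character
    (χ : Gal(AlgebraicClosure F/F) →* Multiplicative (ZMod 2))
    (hχ : {σ | χ σ = 1} ∈ nhds (1 : Gal(AlgebraicClosure F/F))) :
    ∃ α : AlgebraicClosure F, α ≠ 0 ∧ ∀ σ : Gal(AlgebraicClosure F/F),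
      σ α = (signOfZModTwo (χ σ) : AlgebraicClosure F) * α := by
  obtain ⟨E, _, _, hE⟩ := (krullTopology_mem_nhds_one_iff_of_normal F _ _).1 hχ
  let r := AlgEquiv.restrictNormalHom (F := F) (K₁ := AlgebraicClosure F) E
  have hr : Function.Surjective r := AlgEquiv.restrictNormalHom_surjective (AlgebraicClosure F)
  have hker : r.ker ≤ χ.ker := fun σ hσ => hE ((IntermediateField.restrictNormalHom_ker E).le hσ)
  let χE : Gal(E/F) →* Multiplicative (ZMod 2) := r.liftOfSurjective hr ⟨χ, hker⟩
  have hχE : ∀ σ, χE (r σ) = χ σ := fun σ =>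
    MonoidHom.liftOfRightInverse_comp_apply r _ (Function.rightInverse_surjInv hr) ⟨χ, hker⟩ σ
  obtain ⟨α, hα0, hα⟩ := exists_eigenvector_of_character (signOfZModTwo.comp χE)
  refine ⟨α, fun h => hα0 (Subtype.ext h), fun σ => ?_⟩
  have := hα (r σ)
  rw [MonoidHom.comp_apply, hχE] at this
  calc σ α = ((r σ α : E) : AlgebraicClosure F) := (σ.restrictNormal_commutes E α).symm
    _ = _ := by rw [this]; push_cast; rfl

/-- The square of the eigenvector `α` is fixed, so an odd power `d` of it lies in `F`. Were `d = y ^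
2`, then `α ^ m = ± y` would be fixed, although `σ₀` negates `α` and `m` is odd. -/
theorem exists_nonsquare_of_character (h2 : (2 : F) ≠ 0)
    (χ : Gal(AlgebraicClosure F/F) →* Multiplicative (ZMod 2))
    (hχ : {σ | χ σ = 1} ∈ nhds (1 : Gal(AlgebraicClosure F/F))) (hχ1 : ∃ σ, χ σ ≠ 1) :
    ∃ d : F, ¬ ∃ y : F, y ^ 2 = d := by
  obtain ⟨α, hα0, hα⟩ := exists_eigenvector_of_continuous_character χ hχ
  obtain ⟨σ₀, hσ₀⟩ := hχ1
  have h2' : (2 : AlgebraicClosure F) ≠ 0 := by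
    rw [← map_ofNat (algebraMap F (AlgebraicClosure F))]
    exact (_root_.map_ne_zero _).2 h2
  have hσα : σ₀ α = -α := by
    have : signOfZModTwo (χ σ₀) = -1 := if_neg hσ₀
    rw [hα, this, Int.cast_neg, Int.cast_one, neg_one_mul]
  obtain ⟨m, hm, d, hd⟩ := exists_odd_pow_mem_of_fixed h2 (x := α ^ 2) fun σ => by
    rw [map_pow, hα, mul_pow]
    have : signOfZModTwo (χ σ) ^ 2 = 1 := by
      generalize χ σ = t
      revert t
      decide
    rw [← Int.cast_pow, this, Int.cast_one, one_mul]
  refine ⟨d, ?_⟩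
  rintro ⟨y, rfl⟩
  rw [map_pow, ← pow_mul, mul_comm, pow_mul, sq_eq_sq_iff_eq_or_eq_neg] at hd
  have hfix : σ₀ (α ^ m) = α ^ m := by
    rcases hd with h | h
    · rw [← h, σ₀.commutes]
    · rw [← neg_eq_iff_eq_neg.2 h, map_neg, σ₀.commutes]
  rw [map_pow, hσα, hm.neg_pow] at hfix
  apply mul_ne_zero h2' (pow_ne_zero m hα0)
  linear_combination -hfix

theorem card_powerClasses_two_of_zHat (hF : ¬ CharP F 2)
    (e : Gal(AlgebraicClosure F/F) ≃ₜ* Multiplicative zHat) :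
    Nat.card (PowerClasses 2 F) = 2 := by
  have h2 : (2 : F) ≠ 0 := fun h =>
    hF ((CharP.charP_iff_prime_eq_zero Nat.prime_two).2 (by exact_mod_cast h))
  let χ : Gal(AlgebraicClosure F/F) →* Multiplicative (ZMod 2) :=
    (AddMonoidHom.toMultiplicative zHatModTwo).comp (e : Gal(AlgebraicClosure F/F) →* _)
  have hχapp : ∀ σ, χ σ = Multiplicative.ofAdd (zHatModTwo (Multiplicative.toAdd (e σ))) :=
    fun σ => rfl
  have hker : ∀ σ, χ σ = 1 → ∃ τ, τ * τ = σ := by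
    intro σ hσ
    obtain ⟨y, hy⟩ := zHat_exists_add_self_eq (Multiplicative.toAdd (e σ)) hσ
    refine ⟨e.symm (Multiplicative.ofAdd y), ?_⟩
    apply e.injective
    rw [map_mul, ContinuousMulEquiv.apply_symm_apply, ← ofAdd_add, hy, ofAdd_toAdd]
  have hcont : Continuous χ :=
    continuous_ofAdd.comp (continuous_zHatModTwo.comp (continuous_toAdd.comp e.continuous))
  have hopen : {σ | χ σ = 1} ∈ nhds (1 : Gal(AlgebraicClosure F/F)) :=
    ((isOpen_discrete ({1} : Set (Multiplicative (ZMod 2)))).preimage hcont).mem_nhds (map_one χ)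
  have hne : ∃ σ, χ σ ≠ 1 := by
    obtain ⟨z, hz⟩ := zHatModTwo_surjective 1
    refine ⟨e.symm (Multiplicative.ofAdd z), ?_⟩
    rw [hχapp, ContinuousMulEquiv.apply_symm_apply, toAdd_ofAdd, hz]
    decide
  obtain ⟨d, hd⟩ := exists_nonsquare_of_character h2 χ hopen hne
  have hd0 : d ≠ 0 := fun h => hd ⟨0, by rw [h]; ring⟩
  rw [Nat.card_eq_two_iff]
  refine ⟨QuotientGroup.mk 1, QuotientGroup.mk (Units.mk0 d hd0), fun h => hd ?_, ?_⟩
  · simpa using (powerClasses_mk_eq_iff two_pos _ _).1 h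
  · rw [Set.eq_univ_iff_forall]
    intro t
    obtain ⟨u, rfl⟩ := QuotientGroup.mk_surjective t
    by_cases hu : ∃ y : F, y ^ 2 = (u : F)
    · exact Or.inl (((powerClasses_mk_eq_iff two_pos _ _).2 (by simpa using hu)).symm)
    · refine Or.inr ((powerClasses_mk_eq_iff two_pos _ _).2 ?_)
      simpa [mul_comm] using exists_sq_eq_mul_of_character h2 χ hker hu hd

end Quadratic

/-! ### The definability theorem -/

theorem noPDivisibleConvexSubgroup_of_mulEquiv_int {p : ℕ} (hp : 1 < p) {Γ : Type*} [CommGroup Γ]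
    [LinearOrder Γ] (e : Γ ≃* Multiplicative ℤ) : NoPDivisibleConvexSubgroup p Γ := by
  intro H _ hH
  rw [Subgroup.eq_bot_iff_forall]
  -- Descent: a `p`-th root taken within `H` has strictly smaller absolute value unless it is
  -- trivial.
  have key : ∀ (k : ℕ), ∀ h ∈ H, (Multiplicative.toAdd (e h)).natAbs ≤ k → h = 1 := by
    intro k
    induction k with
    | zero =>
      intro h _ hk
      have : Multiplicative.toAdd (e h) = 0 := by omega
      exact e.map_eq_one_iff.1 this
    | succ k ih =>
      intro h hh hk
      obtain ⟨g, hg, rfl⟩ := hH h hh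
      rw [ih g hg, one_pow]
      rw [map_pow, toAdd_pow, nsmul_eq_mul, Int.natAbs_mul, Int.natAbs_natCast] at hk
      nlinarith
  exact fun h hh => key _ h hh le_rfl

theorem definesValuationRing_integralityFormula {N : Set ℕ} (p : N) (hp : (0 : ℕ) < p)
    {K Γ₀ : Type*} [Field K] [LinearOrderedCommGroupWithZero Γ₀] {v : Valuation K Γ₀}
    (H : ∀ a, v a < 1 → ∃ y : K, y ^ (p : ℕ) = 1 + a) {M : ℕ} (hM : 0 < M)
    (hcard : Nat.card (PowerClasses p (residueFieldOf v)) = M)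
    (hΓ : NoPDivisibleConvexSubgroup p (valueGroupOf v)) :
    DefinesValuationRing (integralityFormula p M) v := fun x =>
  (realize_integralityFormula p M x).trans
    (mem_valuationSubring_iff_forall_not hp H hM hcard hΓ x).symm

theorem mainTheorem2 :
    (∀ (p : ℕ) (_ : p.Prime) (n : ℕ),
      ∃ φ : (ringPowerLanguage {p}).Formula (Fin 1), φ.IsUniversal ∧
        ∀ (K : Type*) [Field K] (Γ₀ : Type*) [LinearOrderedCommGroupWithZero Γ₀]
          (v : Valuation K Γ₀),
          IsPHenselianValuation p v →
          (∃ ζ : K, IsPrimitiveRoot ζ p) →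
          ¬ CharP (residueFieldOf v) p →
          Nat.card ((residueFieldOf v)ˣ ⧸
            (powMonoidHom p : (residueFieldOf v)ˣ →* (residueFieldOf v)ˣ).range) = p ^ n →
          NoPDivisibleConvexSubgroup p (valueGroupOf v) →
          DefinesValuationRing φ v) ∧
    (∃ φ : macintyreLanguage.Formula (Fin 1), φ.IsUniversal ∧
      ∀ (K : Type*) [Field K] (Γ₀ : Type*) [LinearOrderedCommGroupWithZero Γ₀]
        (v : Valuation K Γ₀),
        IsHenselianValuation v →
        Nonempty (valueGroupOf v ≃*o Multiplicative ℤ) →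
        ¬ CharP (residueFieldOf v) 2 →
        Nonempty (Field.absoluteGaloisGroup (residueFieldOf v) ≃ₜ* Multiplicative zHat) →
        DefinesValuationRing φ v) := by
  refine ⟨fun p hp n => ⟨integralityFormula ⟨p, Set.mem_singleton p⟩ (p ^ n), isUniversal_integralityFormula _ _, ?_⟩,
    integralityFormula ⟨2, one_le_two (α := ℕ)⟩ 2, isUniversal_integralityFormula _ _, ?_⟩
  · rintro K _ Γ₀ _ v hv ⟨ζ, hζ⟩ hF hcard hΓ
    exact definesValuationRing_integralityFormula ⟨p, Set.mem_singleton p⟩ hp.pos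
      (fun a => exists_pow_eq_of_isPHenselianValuation hp hζ hF hv) (pow_pos hp.pos n) hcard hΓ
  · rintro K _ Γ₀ _ v hv ⟨e⟩ hF ⟨g⟩
    exact definesValuationRing_integralityFormula ⟨2, one_le_two (α := ℕ)⟩ two_pos
      (fun a => exists_sq_eq_of_isHenselianValuation hF hv) two_pos
      (card_powerClasses_two_of_zHat hF g)
      (noPDivisibleConvexSubgroup_of_mulEquiv_int one_lt_two e.toMulEquiv)
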